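/- Let $M=(\mathcal S,\mathcal A,R,P,p_0,\gamma)$ be a Markov decision process on measurable state and action spaces, with measurable reward $R:\mathcal S\times\mathcal A\times\mathcal S\to[0,\bar R]$, transition probabilities $P(\cdot\mid s,a)$, initial law $p_0$ and discount factor $0\le\gamma<1$. Its extended max-reward MDP $\hat M$ has states $(s,y)\in\mathcal S\times\mathbb R$; it starts at $(s_0,0)$ with $s_0\sim p_0$, and from $(s,y)$ under action $a$ it moves to $(s',y')$ with $s'\sim P(\cdot\mid s,a)$ and $y'=\max\{R(s,a,s'),y\}/\gamma$ (for $\gamma=0$ the value given to $y'$ is immaterial). For a policy $\hat\pi(\cdot\mid s,y)$ on $\hat M$ put $r_{t+1}=R(s_t,a_t,s_{t+1})$ and $\hat G_0=\max\{r_1,\gamma r_2,\gamma^2r_3,\dots\}$, and define $$\hat v^{\hat\pi}(s,y)=\mathbb E_{\hat\pi}[\max\{y,\hat G_0\}\mid s_0=s,\,y_0=y],\qquad \hat q^{\hat\pi}(s,a,y)=\mathbb E_{\hat\pi}[\max\{y,\hat G_0\}\mid s_0=s,\,a_0=a,\,y_0=y],$$ $$\hat J(\hat\pi)=\mathbb E_{s_0\sim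 p_0}[\hat v^{\hat\pi}(s_0,0)],\qquad \hat d^{\hat\pi}=\sum_{t=0}^\infty\gamma^t\,\mathrm{Law}_{\hat\pi}(s_t,y_t),$$ where in the last formula the process starts at $(s_0,0)$ with $s_0\sim p_0$. Let $\hat\pi_\theta(a\mid s,y)$, $\theta\in\mathbb R^m$, be a parameterized stochastic policy on $\hat M$, given by probability densities in $a$ with respect to a $\sigma$-finite measure $da$ on $\mathcal A$, measurable in $(s,y,a)$ and differentiable in $\theta$. Assume the following regularity. (i) For each $(s,y)$ and each $\theta_0$ there are a neighbourhood of $\theta_0$ and an integrable function $g$ on $\mathcal A$ such that, for almost every $a$, $\|\nabla_\theta\hat\pi_\theta(a\mid s,y)\|\le g(a)$ for all $\theta$ in this neighbourhood. (ii) For each $\theta_0$ there are a neighbourhood of $\theta_0$ and a constant $C$ such that $\int_{\mathcal A}\|\nabla_\theta\hat\pi_\theta(a\mid s,y)\|\,da\le C$ for all $\theta$ in this neighbourhood, all $s\in\mathcal S$ and all $y\in[0,\bar R]$. Write $\hat J(\theta)=\hat J(\hat\pi_\theta)$. Then, for every $\theta$, the measure $\hat d^{\hat\pi_\theta}$ has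 total mass $1/(1-\gamma)$, the function $\hat J$ is differentiable at $\theta$, and $$\nabla_\theta\hat J(\theta)=\int\mathbb E_{a\sim\hat\pi_\theta(\cdot\mid s,y)}\big[\hat q^{\hat\pi_\theta}(s,a,y)\,\nabla_\theta\ln\hat\pi_\theta(a\mid s,y)\big]\,d\hat d^{\hat\pi_\theta}(s,y),$$ where the inner expectation exists for every $(s,y)$ and is an integrable function of $(s,y)$ with respect to $\hat d^{\hat\pi_\theta}$. Equivalently, $\nabla_\theta\hat J(\theta)$ equals $\frac1{1-\gamma}$ times the expectation of this inner expectation over $(s,y)$ drawn from the probability measure $(1-\gamma)\,\hat d^{\hat\pi_\theta}$; in particular, it is proportional to $\mathbb E_{(s,y)\sim\hat d^{\hat\pi_\theta},\,a\sim\hat\pi_\theta}\big[\hat q^{\hat\pi_\theta}(s,a,y)\,\nabla_\theta\ln\hat\pi_\theta(a\mid s,y)\big]$. -/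

import Mathlib

open MeasureTheory ProbabilityTheory

namespace MaxReward

/-- A Markov decision process `(S, A, R, P, p₀, γ)` with a non-negative, bounded reward. The
transition model is a Markov kernel, so it may have a density with respect to some reference
measure, but it need not have one (the extended process below never has one). -/
structure MDP (S A : Type*) [MeasurableSpace S] [MeasurableSpace A] where
  /-- the reward `R(s, a, s')` -/
  reward : S → A → S → ℝ
  measurable_reward : Measurable fun p : S × A × S => reward p.1 p.2.1 p.2.2
  /-- the upper bound of the rewards -/
  rewardBound : ℝ
  reward_nonneg : ∀ s a s', 0 ≤ reward s a s'
  reward_le : ∀ s a s', reward s a s' ≤ rewardBound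
  /-- the transition model `P(· | s, a)` -/
  trans : Kernel (S × A) S
  isMarkovKernel_trans : IsMarkovKernel trans
  /-- the law of the initial state -/
  init : Measure S
  isProbabilityMeasure_init : IsProbabilityMeasure init
  /-- the discount factor -/
  discount : ℝ
  discount_nonneg : 0 ≤ discount
  discount_lt_one : discount < 1

namespace MDP

variable {S A : Type*} [MeasurableSpace S] [MeasurableSpace A]

instance (M : MDP S A) : IsMarkovKernel M.trans := M.isMarkovKernel_trans

instance (M : MDP S A) : IsProbabilityMeasure M.init := M.isProbabilityMeasure_init

/-! ### Trajectories under a policy -/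

/-- One step of the state-action process under the policy `π`:
from `(s, a)` draw `s' ∼ P(· | s, a)` and then `a' ∼ π(· | s')`. -/
noncomputable def stepKernel (M : MDP S A) (π : Kernel S A) : Kernel (S × A) (S × A) :=
  (Kernel.id ×ₖ π) ∘ₖ M.trans

instance (M : MDP S A) (π : Kernel S A) [IsMarkovKernel π] :
    IsMarkovKernel (M.stepKernel π) := by
  unfold stepKernel; infer_instance

/-- The transition of the state-action process at time `n`, given the whole history. -/
noncomputable def historyKernel (M : MDP S A) (π : Kernel S A) (n : ℕ) :
    Kernel (Π _ : Finset.Iic n, S × A) (S × A) :=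
  (M.stepKernel π).comap (fun h => h ⟨n, Finset.mem_Iic.2 le_rfl⟩) (measurable_pi_apply _)

instance (M : MDP S A) (π : Kernel S A) [IsMarkovKernel π] (n : ℕ) :
    IsMarkovKernel (M.historyKernel π n) := by
  unfold historyKernel; infer_instance

/-- The law of the trajectory `(s₀, a₀), (s₁, a₁), …` given `s₀ = s` and `a₀ = a`, all later
actions being drawn from `π`. -/
noncomputable def pathFromStateAction (M : MDP S A) (π : Kernel S A) [IsMarkovKernel π] :
    Kernel (S × A) (ℕ → S × A) :=
  (Kernel.traj (X := fun _ => S × A) (M.historyKernel π) 0).comap (fun z _ => z)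
    (measurable_pi_lambda _ fun _ => measurable_id)

/-- The law of the trajectory `(s₀, a₀), (s₁, a₁), …` given `s₀ = s`, all actions being drawn
from `π`. -/
noncomputable def pathFromState (M : MDP S A) (π : Kernel S A) [IsMarkovKernel π] :
    Kernel S (ℕ → S × A) :=
  M.pathFromStateAction π ∘ₖ (Kernel.id ×ₖ π)

/-- The max-reward return `max {r₁, γ r₂, γ² r₃, …}` of a trajectory, with
`r_{i+1} = R(s_i, a_i, s_{i+1})`. -/
noncomputable def maxReturn (M : MDP S A) (ω : ℕ → S × A) : ℝ :=
  ⨆ i : ℕ, M.discount ^ i * M.reward (ω i).1 (ω i).2 (ω (i + 1)).1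

/-! ### Discounted state visitation -/

/-- The on-policy transition model `P^π(s' | s) = ∫ π(a | s) P(s' | s, a) da`. -/
noncomputable def onPolicyTrans (M : MDP S A) (π : Kernel S A) : Kernel S S :=
  M.trans ∘ₖ (Kernel.id ×ₖ π)

/-- `p_t(s₀, ·)`, the law of the state after `t` steps under `π` when started from `s₀`. -/
noncomputable def stateLaw (M : MDP S A) (π : Kernel S A) : ℕ → Kernel S S
  | 0 => Kernel.id
  | t + 1 => M.onPolicyTrans π ∘ₖ stateLaw M π t

/-- The discounted state-visitation measure
`d^π = ∫ p₀(s₀) ∑ₜ γᵗ p_t(s₀, ·) ds₀`, of total mass `1 / (1 - γ)`. -/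
noncomputable def visitation (M : MDP S A) (π : Kernel S A) : Measure S :=
  Measure.sum fun t : ℕ => ENNReal.ofReal (M.discount ^ t) • M.init.bind (M.stateLaw π t)

/-- The discounted state-visitation measure, divided by its total mass. -/
noncomputable def visitationLaw (M : MDP S A) (π : Kernel S A) : Measure S :=
  (M.visitation π Set.univ)⁻¹ • M.visitation π

/-! ### The extended max-reward MDP -/

lemma measurable_extendedNext (M : MDP S A) :
    Measurable fun p : ((S × ℝ) × A) × S =>
      (p.2, max (M.reward p.1.1.1 p.1.2 p.2) p.1.1.2 / M.discount) := by
  refine measurable_snd.prodMk ((Measurable.max ?_ (by fun_prop)).div_const _)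
  exact M.measurable_reward.comp (f := fun p : ((S × ℝ) × A) × S => (p.1.1.1, p.1.2, p.2))
    (by fun_prop)

/-- The extended transition model on `S × ℝ`: from `(s, y)` and `a`, draw `s' ∼ P(· | s, a)` and
put `y' = max (R(s, a, s')) y / γ`. -/
noncomputable def extendedTrans (M : MDP S A) : Kernel ((S × ℝ) × A) (S × ℝ) where
  toFun z := (M.trans (z.1.1, z.2)).map fun s' =>
    (s', max (M.reward z.1.1 z.2 s') z.1.2 / M.discount)
  measurable' := by
    have h : Measurable fun z : (S × ℝ) × A => (z.1.1, z.2) := by fun_prop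
    have key : (fun z : (S × ℝ) × A => (M.trans (z.1.1, z.2)).map fun s' =>
          (s', max (M.reward z.1.1 z.2 s') z.1.2 / M.discount)) =
        fun z => ((Kernel.id ×ₖ M.trans.comap _ h).map
          fun p : ((S × ℝ) × A) × S =>
            (p.2, max (M.reward p.1.1.1 p.1.2 p.2) p.1.1.2 / M.discount)) z := by
      funext z
      rw [Kernel.map_apply _ M.measurable_extendedNext, Kernel.prod_apply, Kernel.id_apply,
        Kernel.comap_apply, Measure.dirac_prod,
        Measure.map_map M.measurable_extendedNext measurable_prodMk_left]
      rfl
    rw [key]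
    exact Kernel.measurable _

instance (M : MDP S A) : IsMarkovKernel M.extendedTrans where
  isProbabilityMeasure z :=
    Measure.isProbabilityMeasure_map
      (M.measurable_extendedNext.comp (measurable_prodMk_left (x := z))).aemeasurable

/-- The extended max-reward MDP, with states `(s, y) ∈ S × ℝ`, started at `y₀ = 0`. -/
noncomputable def extended (M : MDP S A) : MDP (S × ℝ) A where
  reward x a x' := M.reward x.1 a x'.1
  measurable_reward := M.measurable_reward.comp
    (f := fun p : (S × ℝ) × A × (S × ℝ) => (p.1.1, p.2.1, p.2.2.1)) (by fun_prop)
  rewardBound := M.rewardBound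
  reward_nonneg _ _ _ := M.reward_nonneg _ _ _
  reward_le _ _ _ := M.reward_le _ _ _
  trans := M.extendedTrans
  isMarkovKernel_trans := inferInstance
  init := M.init.prod (Measure.dirac 0)
  isProbabilityMeasure_init := inferInstance
  discount := M.discount
  discount_nonneg := M.discount_nonneg
  discount_lt_one := M.discount_lt_one

/-! ### Max-reward value functions of an extended policy -/

/-- `v̂^π(s, y) = E_π[max y Ĝ₀ | s₀ = s, y₀ = y]` for an extended policy `π`. -/
noncomputable def vHat (M : MDP S A) (π : Kernel (S × ℝ) A) [IsMarkovKernel π]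
    (s : S) (y : ℝ) : ℝ :=
  ∫ ω, max y (M.extended.maxReturn ω) ∂(M.extended.pathFromState π (s, y))

/-- `q̂^π(s, a, y) = E_π[max y Ĝ₀ | s₀ = s, a₀ = a, y₀ = y]` for an extended policy `π`. -/
noncomputable def qHat (M : MDP S A) (π : Kernel (S × ℝ) A) [IsMarkovKernel π]
    (s : S) (a : A) (y : ℝ) : ℝ :=
  ∫ ω, max y (M.extended.maxReturn ω) ∂(M.extended.pathFromStateAction π ((s, y), a))

/-- The max-reward objective `Ĵ(π) = E_{s₀ ∼ p₀}[v̂^π(s₀, 0)]`. -/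
noncomputable def JHat (M : MDP S A) (π : Kernel (S × ℝ) A) [IsMarkovKernel π] : ℝ :=
  ∫ s, M.vHat π s 0 ∂M.init

end MDP

/-- A stochastic policy on the state space `X`, parameterized by `θ ∈ Θ`, and given by its
densities `π_θ(a | x)` with respect to the reference measure `ν` on the action space. -/
structure ParamPolicy (Θ X : Type*) {A : Type*} [MeasurableSpace X] [MeasurableSpace A]
    (ν : Measure A) where
  /-- the density `π_θ(a | x)` -/
  density : Θ → X → A → ℝ
  measurable_density : ∀ θ, Measurable fun p : X × A => density θ p.1 p.2
  density_nonneg : ∀ θ x a, 0 ≤ density θ x a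
  lintegral_density : ∀ θ x, ∫⁻ a, ENNReal.ofReal (density θ x a) ∂ν = 1

namespace ParamPolicy

variable {Θ X A : Type*} [MeasurableSpace X] [MeasurableSpace A] {ν : Measure A}

/-- The policy with parameter `θ`, as a Markov kernel: `π_θ(da | x) = π_θ(a | x) ν(da)`. -/
noncomputable def toKernel [SFinite ν] (p : ParamPolicy Θ X ν) (θ : Θ) : Kernel X A where
  toFun x := ν.withDensity fun a => ENNReal.ofReal (p.density θ x a)
  measurable' := by
    have hm : Measurable (Function.uncurry fun x a => ENNReal.ofReal (p.density θ x a)) :=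
      (p.measurable_density θ).ennreal_ofReal
    have key : (fun x => ν.withDensity fun a => ENNReal.ofReal (p.density θ x a)) =
        fun x => ((Kernel.const X ν).withDensity
          fun x a => ENNReal.ofReal (p.density θ x a)) x := by
      funext x
      rw [Kernel.withDensity_apply _ hm, Kernel.const_apply]
    rw [key]
    exact Kernel.measurable _

instance [SFinite ν] (p : ParamPolicy Θ X ν) (θ : Θ) : IsMarkovKernel (p.toKernel θ) where
  isProbabilityMeasure x := ⟨by
    change (ν.withDensity fun a => ENNReal.ofReal (p.density θ x a)) Set.univ = 1
    rw [withDensity_apply _ MeasurableSet.univ, Measure.restrict_univ, p.lintegral_density]⟩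

end ParamPolicy

end MaxReward

/-! The division by γ in the record makes the max-reward criterion discounted and additive. Since Ĝ₀
= max{r₁, γĜ₁}, one has max{y, Ĝ₀} = γ max{y', Ĝ₁} for γ > 0. Subtracting y⁺ gives the `excess`,
which lies in [0, R̄], vanishes for y ≥ R̄, and satisfies an ordinary Bellman equation with bounded
reward `gain` and discount γ (`excess_eq_gain_add`, `excessQ_eq`). The subtracted y⁺ does not depend
on the action, so it acts as a baseline: it drops out of the gradient because ∫ ∇π_θ da = 0.

For the excess, telescoping along the visitation measure gives the performance difference formula
`JHat_sub`: Ĵ(η) - Ĵ(θ) = ∫ (∫ Q_η dπ_η - ∫ Q_η dπ_θ) d d̂_θ, with Q at the new parameter η and the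
visitation measure at the old one. Replacing Q_η by Q_θ leaves F(η) - F(θ), where F(η) = ∫∫ Q_θ dπ_η
d d̂_θ. The error is quadratic in ‖η - θ‖: the integrand Q_η - Q_θ is O(‖η - θ‖) by the Bellman
equation (`abs_excessQ_sub_le`), and it is tested against π_η - π_θ, which is again O(‖η - θ‖).
Hence Ĵ and F have the same gradient at θ, and F is differentiated under the integral sign
(`hasGradientAt_integral_visitation`). No continuity or differentiability of Q or of d̂ in θ has to
be established beforehand.

The `L¹` bound on the gradient of the policy is available only for y ∈ [0, R̄]. This suffices:
reached records are almost surely non-negative, and above R̄ the excess is zero. -/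

namespace MaxReward

/-! ### Time-homogeneous Markov chains: uniqueness of the law and the Markov property at time one.
-/

section MarkovChain

open Finset Preorder

variable {Z : Type*} [MeasurableSpace Z]

/-- Two laws of processes agree if their restrictions to initial segments of times agree. -/
lemma measure_eq_of_map_frestrictLe {P Q : Measure (ℕ → Z)} [IsFiniteMeasure Q]
    (h : ∀ n, P.map (frestrictLe (π := fun _ => Z) n) = Q.map (frestrictLe n)) : P = Q := by
  -- Every finite set of times lies in an initial segment, so the restrictions to initial segments
  -- determine all finite-dimensional marginals.
  refine IsProjectiveLimit.unique (P := fun I : Finset ℕ => Q.map I.restrict) (fun I => ?_)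
    fun I => rfl
  have hI : I ⊆ Iic (I.sup id) := fun i hi => mem_Iic.2 (le_sup (f := id) hi)
  have hm : Measurable (restrict₂ (π := fun _ => Z) hI) := measurable_restrict₂ hI
  have hc : I.restrict (π := fun _ => Z) =
    restrict₂ (π := fun _ => Z) hI ∘ frestrictLe (I.sup id) := rfl
  rw [hc, ← Measure.map_map hm (by fun_prop), h,
    Measure.map_map hm (by fun_prop)]
  rfl

/-- The transition of a time-homogeneous Markov chain, as a kernel on histories. -/
noncomputable def markovHistory (K : Kernel Z Z) (n : ℕ) : Kernel (Π _ : Iic n, Z) Z :=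
  K.comap (fun h => h ⟨n, mem_Iic.2 le_rfl⟩) (measurable_pi_apply _)

instance (K : Kernel Z Z) [IsMarkovKernel K] (n : ℕ) : IsMarkovKernel (markovHistory K n) := by
  unfold markovHistory; infer_instance

/-- A process whose one-step transitions are given by the kernel `K`. -/
def IsMarkovLaw (K : Kernel Z Z) (P : Measure (ℕ → Z)) : Prop :=
  ∀ n, P.map (frestrictLe (π := fun _ => Z) n) ⊗ₘ markovHistory K n =
    P.map fun ω => (frestrictLe (π := fun _ => Z) n ω, ω (n + 1))

/-- The law of a Markov chain is determined by its initial law and its transition kernel. -/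
lemma IsMarkovLaw.ext {K : Kernel Z Z} {P Q : Measure (ℕ → Z)} [IsFiniteMeasure Q]
    (hP : IsMarkovLaw K P) (hQ : IsMarkovLaw K Q)
    (h0 : P.map (fun ω => ω 0) = Q.map fun ω => ω 0) : P = Q := by
  refine measure_eq_of_map_frestrictLe fun n => ?_
  induction n with
  | zero =>
    let e : Z → (Π _ : Iic 0, Z) := fun z _ => z
    have he : Measurable e := measurable_pi_lambda _ fun _ => measurable_id
    have hc : (frestrictLe (π := fun _ => Z) 0) = e ∘ fun ω => ω 0 := by
      funext ω i
      obtain ⟨i, hi⟩ := i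
      obtain rfl : i = 0 := by simpa using hi
      rfl
    rw [hc, ← Measure.map_map he (by fun_prop), h0, Measure.map_map he (by fun_prop)]
  | succ n ih =>
    -- Appending the next point to a history: the law up to time n + 1 is an image of the joint law
    -- that `IsMarkovLaw` prescribes.
    let e : (Π _ : Iic n, Z) × Z → (Π _ : Iic (n + 1), Z) := fun p i =>
      if h : (i : ℕ) ≤ n then p.1 ⟨i, mem_Iic.2 h⟩ else p.2
    have he : Measurable e := by
      refine measurable_pi_lambda _ fun i => ?_
      by_cases h : (i : ℕ) ≤ n
      · simp only [e, h, dite_true]; fun_prop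
      · simp only [e, h, dite_false]; fun_prop
    have hc : (frestrictLe (π := fun _ => Z) (n + 1)) =
        e ∘ fun ω => (frestrictLe (π := fun _ => Z) n ω, ω (n + 1)) := by
      funext ω i
      obtain ⟨i, hi⟩ := i
      by_cases h : i ≤ n
      · simp [e, h]
      · obtain rfl : i = n + 1 := by have := mem_Iic.1 hi; omega
        simp [e]
    rw [hc, ← Measure.map_map he (by fun_prop), ← hP n, ih, hQ n,
      Measure.map_map he (by fun_prop)]

/-- The time shift of a trajectory. -/
def shift (ω : ℕ → Z) : ℕ → Z := fun n => ω (n + 1)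

lemma measurable_shift : Measurable (shift : (ℕ → Z) → ℕ → Z) :=
  measurable_pi_lambda _ fun _ => measurable_pi_apply _

/-- The Markov property is stable under time shifts. -/
lemma IsMarkovLaw.map_shift {K : Kernel Z Z} [IsMarkovKernel K] {P : Measure (ℕ → Z)}
    [IsFiniteMeasure P] (hP : IsMarkovLaw K P) : IsMarkovLaw K (P.map shift) := by
  intro n
  -- Forgetting time 0. The transition uses only the last point of a history, so it is unaffected.
  let φ : (Π _ : Iic (n + 1), Z) → (Π _ : Iic n, Z) := fun h i =>
    h ⟨i + 1, mem_Iic.2 (Nat.succ_le_succ (mem_Iic.1 i.2))⟩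
  have hφ : Measurable φ := measurable_pi_lambda _ fun _ => measurable_pi_apply _
  have h1 : (P.map shift).map (frestrictLe (π := fun _ => Z) n) =
      (P.map (frestrictLe (π := fun _ => Z) (n + 1))).map φ := by
    rw [Measure.map_map (by fun_prop) measurable_shift, Measure.map_map hφ (by fun_prop)]
    rfl
  have h2 : (P.map shift).map (fun ω => (frestrictLe (π := fun _ => Z) n ω, ω (n + 1))) =
      (P.map fun ω => (frestrictLe (π := fun _ => Z) (n + 1) ω, ω (n + 1 + 1))).map
        (Prod.map φ id) := by
    rw [Measure.map_map (by fun_prop) measurable_shift, Measure.map_map (by fun_prop)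
      (by fun_prop)]
    rfl
  rw [h1, h2, ← hP (n + 1)]
  ext s hs
  rw [Measure.compProd_apply hs, Measure.map_apply (by fun_prop) hs,
    Measure.compProd_apply (hs.preimage (by fun_prop)), lintegral_map
      (Kernel.measurable_kernel_prodMk_left hs) hφ]
  rfl

variable (K : Kernel Z Z) [IsMarkovKernel K]

lemma isMarkovLaw_trajMeasure (μ : Measure Z) [IsProbabilityMeasure μ] :
    IsMarkovLaw K (Kernel.trajMeasure (X := fun _ => Z) μ (markovHistory K)) := fun _ =>
  Kernel.map_frestrictLe_trajMeasure_compProd_eq_map_trajMeasure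

/-- The law of the Markov chain with transition kernel `K`, as a kernel of the initial point. -/
noncomputable def markovPath : Kernel Z (ℕ → Z) :=
  (Kernel.traj (X := fun _ => Z) (markovHistory K) 0).comap (fun z _ => z)
    (measurable_pi_lambda _ fun _ => measurable_id)

instance : IsMarkovKernel (markovPath K) := by unfold markovPath; infer_instance

/-- Transfers the Markov property known for `trajMeasure` to mixtures of `markovPath`, and through
Dirac masses to `markovPath` itself. -/
lemma trajMeasure_eq_bind (μ : Measure Z) :
    Kernel.trajMeasure (X := fun _ => Z) μ (markovHistory K) = μ.bind (markovPath K) := by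
  have he : Measurable (fun (z : Z) (_ : Iic 0) => z) :=
    measurable_pi_lambda _ fun _ => measurable_id
  have h : ⇑(MeasurableEquiv.piUnique fun _ : Iic 0 => Z).symm = fun z _ => z := by
    funext z i
    obtain ⟨i, hi⟩ := i
    obtain rfl : i = 0 := by simpa using hi
    rfl
  ext s hs
  rw [Kernel.trajMeasure, h, Measure.bind_apply hs (Kernel.aemeasurable _),
    Measure.bind_apply hs (Kernel.aemeasurable _), lintegral_map (Kernel.measurable_coe _ hs) he]
  rfl

lemma markovPath_map_zero (z : Z) :
    (markovPath K z).map (fun ω => ω 0) = Measure.dirac z := by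
  have hm : Measurable (fun h : Π _ : Iic 0, Z => h ⟨0, mem_Iic.2 le_rfl⟩) :=
    measurable_pi_apply _
  have hc : (fun ω : ℕ → Z => ω 0) =
      (fun h : Π _ : Iic 0, Z => h ⟨0, mem_Iic.2 le_rfl⟩) ∘ frestrictLe (π := fun _ => Z) 0 := rfl
  rw [hc, ← Measure.map_map hm (by fun_prop), markovPath, Kernel.comap_apply,
    Kernel.traj_map_frestrictLe_apply, Kernel.partialTraj_self, Kernel.id_apply,
    Measure.map_dirac' hm]

lemma markovPath_bind_map_zero (μ : Measure Z) :
    (μ.bind (markovPath K)).map (fun ω => ω 0) = μ := by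
  ext s hs
  rw [Measure.map_apply (by fun_prop) hs, Measure.bind_apply (hs.preimage (by fun_prop))
    (Kernel.aemeasurable _)]
  have : ∀ z, markovPath K z ((fun ω => ω 0) ⁻¹' s) = s.indicator 1 z := fun z => by
    rw [← Measure.map_apply (by fun_prop) hs, markovPath_map_zero, Measure.dirac_apply' _ hs]
  simp_rw [this]
  rw [lintegral_indicator_one hs]

lemma isMarkovLaw_bind (μ : Measure Z) [IsProbabilityMeasure μ] :
    IsMarkovLaw K (μ.bind (markovPath K)) :=
  trajMeasure_eq_bind K μ ▸ isMarkovLaw_trajMeasure K μ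

lemma isMarkovLaw_markovPath (z : Z) : IsMarkovLaw K (markovPath K z) := by
  have := isMarkovLaw_bind K (Measure.dirac z)
  rwa [Measure.dirac_bind (Kernel.measurable _)] at this

/-- The joint law of the first two points of a Markov chain. -/
lemma markovPath_map_zero_one (z : Z) :
    (markovPath K z).map (fun ω => (ω 0, ω 1)) = (K z).map (Prod.mk z) := by
  have hm : Measurable (fun h : Π _ : Iic 0, Z => h ⟨0, mem_Iic.2 le_rfl⟩) :=
    measurable_pi_apply _
  have h := congrArg (Measure.map (Prod.map
    (fun h : Π _ : Iic 0, Z => h ⟨0, mem_Iic.2 le_rfl⟩) id)) (isMarkovLaw_markovPath K z 0)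
  rw [Measure.map_map (by fun_prop) (by fun_prop)] at h
  refine h.symm.trans ?_
  ext s hs
  have hK := Kernel.measurable_kernel_prodMk_left (κ := K) hs
  have hs' := hs.preimage (hm.prodMap measurable_id)
  rw [Measure.map_apply (by fun_prop) hs, Measure.compProd_apply hs',
    lintegral_map (Kernel.measurable_kernel_prodMk_left hs') (by fun_prop),
    Measure.map_apply (by fun_prop) hs]
  change ∫⁻ ω, K (ω 0) (Prod.mk (ω 0) ⁻¹' s) ∂markovPath K z = _
  rw [← lintegral_map (f := fun z => K z (Prod.mk z ⁻¹' s)) (g := fun ω : ℕ → Z => ω 0)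
    hK (by fun_prop), markovPath_map_zero, lintegral_dirac' _ hK]

lemma markovPath_map_one (z : Z) : (markovPath K z).map (fun ω => ω 1) = K z := by
  have h := congrArg (Measure.map Prod.snd) (markovPath_map_zero_one K z)
  rw [Measure.map_map (by fun_prop) (by fun_prop), Measure.map_map (by fun_prop) (by fun_prop)]
    at h
  exact h.trans Measure.map_id

/-- The Markov property at time one. -/
lemma markovPath_map_shift (z : Z) :
    (markovPath K z).map shift = (K z).bind (markovPath K) := by
  refine (isMarkovLaw_markovPath K z).map_shift.ext (isMarkovLaw_bind K (K z)) ?_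
  rw [markovPath_bind_map_zero, Measure.map_map (by fun_prop) measurable_shift]
  exact markovPath_map_one K z

/-- Lifts an almost sure property of a single transition to the first two points of the trajectory.
-/
lemma markovPath_ae_zero_one {z : Z} {p : Z × Z → Prop} (hp : MeasurableSet {x | p x})
    (hz : ∀ᵐ z' ∂K z, p (z, z')) : ∀ᵐ ω ∂markovPath K z, p (ω 0, ω 1) := by
  have h : ∀ᵐ x ∂(markovPath K z).map (fun ω => (ω 0, ω 1)), p x := by
    rw [markovPath_map_zero_one, ae_map_iff (by fun_prop) hp]
    exact hz
  exact ae_of_ae_map ((measurable_pi_apply 0).prodMk (measurable_pi_apply 1)).aemeasurable h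

end MarkovChain

/-! ### Integrals of bounded functions against kernels. -/

section KernelIntegrals

variable {X Y : Type*} [MeasurableSpace X] [MeasurableSpace Y]

lemma integrable_of_abs_le {μ : Measure X} [IsFiniteMeasure μ] {f : X → ℝ} (hf : Measurable f)
    {C : ℝ} (hC : ∀ x, |f x| ≤ C) : Integrable f μ :=
  Integrable.of_bound hf.aestronglyMeasurable C (ae_of_all _ hC)

lemma abs_integral_le_of_abs_le {μ : Measure X} [IsProbabilityMeasure μ] {f : X → ℝ}
    {C : ℝ} (hC : ∀ᵐ x ∂μ, |f x| ≤ C) : |∫ x, f x ∂μ| ≤ C := by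
  simpa using norm_integral_le_of_norm_le_const (f := f) hC

lemma measurable_integral_kernel {κ : Kernel X Y} [IsSFiniteKernel κ] {f : Y → ℝ}
    (hf : Measurable f) : Measurable fun x => ∫ y, f y ∂κ x :=
  hf.stronglyMeasurable.integral_kernel.measurable

lemma measurable_integral_kernel_prod {κ : Kernel X Y} [IsSFiniteKernel κ] {f : X × Y → ℝ}
    (hf : Measurable f) : Measurable fun x => ∫ y, f (x, y) ∂κ x :=
  hf.stronglyMeasurable.integral_kernel_prod_right'.measurable

lemma integral_bind_of_abs_le {μ : Measure X} [IsFiniteMeasure μ] {κ : Kernel X Y}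
    [IsMarkovKernel κ] {f : Y → ℝ} (hf : Measurable f) {C : ℝ} (hC : ∀ y, |f y| ≤ C) :
    ∫ y, f y ∂μ.bind κ = ∫ x, ∫ y, f y ∂κ x ∂μ := by
  have h := Kernel.integral_comp (κ := Kernel.const Unit μ) (η := κ) (a := ())
    (f := f) (integrable_of_abs_le hf hC)
  rwa [Kernel.comp_apply, Kernel.const_apply] at h

lemma id_prod_apply_eq_map (κ : Kernel X Y) [IsSFiniteKernel κ] (x : X) :
    (Kernel.id ×ₖ κ) x = (κ x).map (Prod.mk x) := by
  rw [Kernel.prod_apply, Kernel.id_apply, Measure.dirac_prod]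

lemma integral_id_prod (κ : Kernel X Y) [IsSFiniteKernel κ] (x : X) {f : X × Y → ℝ}
    (hf : Measurable f) : ∫ p, f p ∂(Kernel.id ×ₖ κ) x = ∫ y, f (x, y) ∂κ x := by
  rw [id_prod_apply_eq_map, integral_map (by fun_prop) hf.aestronglyMeasurable]

end KernelIntegrals

/-! ### The excess return and its Bellman equation. -/

namespace MDP

section General

variable {X A : Type*} [MeasurableSpace X] [MeasurableSpace A] (N : MDP X A)
  (π : Kernel X A) [IsMarkovKernel π]

lemma pathFromStateAction_eq : N.pathFromStateAction π = markovPath (N.stepKernel π) := rfl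

lemma integral_stepKernel {f : X × A → ℝ} (hf : Measurable f) {C : ℝ} (hC : ∀ z, |f z| ≤ C)
    (z : X × A) :
    ∫ z', f z' ∂N.stepKernel π z = ∫ x, ∫ a, f (x, a) ∂π x ∂N.trans z := by
  rw [stepKernel, Kernel.comp_apply, integral_bind_of_abs_le hf hC]
  simp_rw [integral_id_prod π _ hf]

lemma integral_onPolicyTrans {f : X → ℝ} (hf : Measurable f) {C : ℝ} (hC : ∀ x, |f x| ≤ C)
    (x : X) :
    ∫ x', f x' ∂N.onPolicyTrans π x = ∫ a, ∫ x', f x' ∂N.trans (x, a) ∂π x := by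
  rw [onPolicyTrans, Kernel.comp_apply, integral_bind_of_abs_le hf hC,
    integral_id_prod π _ (measurable_integral_kernel hf)]

lemma integral_pathFromState {f : (ℕ → X × A) → ℝ} (hf : Measurable f) {C : ℝ}
    (hC : ∀ ω, |f ω| ≤ C) (x : X) :
    ∫ ω, f ω ∂N.pathFromState π x = ∫ a, ∫ ω, f ω ∂N.pathFromStateAction π (x, a) ∂π x := by
  have : IsMarkovKernel (N.pathFromStateAction π) := inferInstanceAs
    (IsMarkovKernel (markovPath (N.stepKernel π)))
  rw [pathFromState, Kernel.comp_apply, integral_bind_of_abs_le hf hC,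
    integral_id_prod π _ (measurable_integral_kernel hf)]

lemma stepKernel_map_fst (z : X × A) : (N.stepKernel π z).map Prod.fst = N.trans z := by
  ext s hs
  rw [Measure.map_apply measurable_fst hs, stepKernel, Kernel.comp_apply,
    Measure.bind_apply (hs.preimage measurable_fst) (Kernel.aemeasurable _)]
  have : ∀ x, (Kernel.id ×ₖ π) x (Prod.fst ⁻¹' s) = s.indicator 1 x := fun x => by
    rw [id_prod_apply_eq_map, Measure.map_apply (by fun_prop) (hs.preimage measurable_fst)]
    by_cases hx : x ∈ s <;> simp [Set.preimage_preimage, hx]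
  simp_rw [this]
  rw [lintegral_indicator_one hs]

lemma measurable_maxReturn : Measurable N.maxReturn :=
  Measurable.iSup fun i => measurable_const.mul (N.measurable_reward.comp
    (f := fun ω : ℕ → X × A => ((ω i).1, (ω i).2, (ω (i + 1)).1)) (by fun_prop))

lemma discounted_reward_le (ω : ℕ → X × A) (i : ℕ) :
    N.discount ^ i * N.reward (ω i).1 (ω i).2 (ω (i + 1)).1 ≤ N.rewardBound :=
  (mul_le_of_le_one_left (N.reward_nonneg _ _ _)
    (pow_le_one₀ N.discount_nonneg N.discount_lt_one.le)).trans (N.reward_le _ _ _)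

lemma bddAbove_discounted_reward (ω : ℕ → X × A) : BddAbove (Set.range fun i : ℕ =>
    N.discount ^ i * N.reward (ω i).1 (ω i).2 (ω (i + 1)).1) :=
  ⟨N.rewardBound, by rintro _ ⟨i, rfl⟩; exact N.discounted_reward_le ω i⟩

lemma maxReturn_nonneg (ω : ℕ → X × A) : 0 ≤ N.maxReturn ω :=
  Real.iSup_nonneg fun _ => mul_nonneg (pow_nonneg N.discount_nonneg _) (N.reward_nonneg _ _ _)

lemma maxReturn_le (ω : ℕ → X × A) : N.maxReturn ω ≤ N.rewardBound :=
  ciSup_le fun i => N.discounted_reward_le ω i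

/-- The max-reward return satisfies the recursion `G₀ = max r₁ (γ G₁)`. -/
lemma maxReturn_eq_max (ω : ℕ → X × A) : N.maxReturn ω =
    max (N.reward (ω 0).1 (ω 0).2 (ω 1).1) (N.discount * N.maxReturn (shift ω)) := by
  have hb := N.bddAbove_discounted_reward ω
  apply le_antisymm
  · refine ciSup_le fun i => ?_
    cases i with
    | zero => simp
    | succ i =>
      refine le_max_of_le_right ?_
      rw [pow_succ', mul_assoc]
      exact mul_le_mul_of_nonneg_left
        (le_ciSup (N.bddAbove_discounted_reward (shift ω)) i) N.discount_nonneg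
  · refine max_le ?_ ?_
    · simpa only [pow_zero, one_mul] using! le_ciSup hb 0
    · rw [maxReturn, Real.mul_iSup_of_nonneg N.discount_nonneg]
      refine ciSup_le fun i => le_trans (le_of_eq ?_) (le_ciSup hb (i + 1))
      simp only [shift]
      ring

end General

variable {S A : Type*} [MeasurableSpace S] [MeasurableSpace A] (M : MDP S A)

/-- The excess `max y₀ Ĝ₀ - y₀⁺` of the max-reward return of an extended trajectory over the
initial record. Unlike `max y₀ Ĝ₀` it is bounded, and it is the return of a process with the
additive rewards `(r_{t+1} - y_t⁺)⁺`. -/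
noncomputable def excess (ω : ℕ → (S × ℝ) × A) : ℝ :=
  max (ω 0).1.2 (M.extended.maxReturn ω) - max (ω 0).1.2 0

lemma measurable_excess : Measurable M.excess := by
  have := M.extended.measurable_maxReturn
  unfold excess
  fun_prop

lemma excess_nonneg (ω : ℕ → (S × ℝ) × A) : 0 ≤ M.excess ω :=
  sub_nonneg.2 (max_le_max_left _ (M.extended.maxReturn_nonneg ω))

lemma excess_le (ω : ℕ → (S × ℝ) × A) : M.excess ω ≤ M.rewardBound := by
  have h0 := M.extended.maxReturn_nonneg ω
  have h1 : M.extended.maxReturn ω ≤ M.rewardBound := M.extended.maxReturn_le ω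
  rw [excess, sub_le_iff_le_add]
  refine max_le ?_ ?_
  · linarith [le_max_left (ω 0).1.2 0]
  · linarith [le_max_right (ω 0).1.2 0]

lemma abs_excess_le (ω : ℕ → (S × ℝ) × A) : |M.excess ω| ≤ M.rewardBound := by
  rw [abs_of_nonneg (M.excess_nonneg ω)]
  exact M.excess_le ω

/-- No reward can beat a record above the reward bound. This makes policy estimates at such states
unnecessary. -/
lemma excess_eq_zero {ω : ℕ → (S × ℝ) × A} (h : M.rewardBound ≤ (ω 0).1.2) :
    M.excess ω = 0 := by
  have h0 := M.extended.maxReturn_nonneg ω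
  have h1 : M.extended.maxReturn ω ≤ M.rewardBound := M.extended.maxReturn_le ω
  rw [excess, max_eq_left (h1.trans h), max_eq_left (h0.trans (h1.trans h)), sub_self]

/-- The additive reward `(R(s, a, s') - y⁺)⁺` of the extended process. -/
noncomputable def gain (z : (S × ℝ) × A) (x : S × ℝ) : ℝ :=
  max (M.reward z.1.1 z.2 x.1) z.1.2 - max z.1.2 0

lemma measurable_gain : Measurable fun p : ((S × ℝ) × A) × (S × ℝ) => M.gain p.1 p.2 := by
  have := M.measurable_reward.comp
    (f := fun p : ((S × ℝ) × A) × (S × ℝ) => (p.1.1.1, p.1.2, p.2.1)) (by fun_prop)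
  simp only [Function.comp_def] at this
  unfold gain
  fun_prop

lemma abs_gain_le (z : (S × ℝ) × A) (x : S × ℝ) : |M.gain z x| ≤ M.rewardBound := by
  have h0 := M.reward_nonneg z.1.1 z.2 x.1
  have h1 := M.reward_le z.1.1 z.2 x.1
  rw [gain, abs_le]
  constructor
  · rcases max_cases z.1.2 0 with h | h <;>
      linarith [le_max_left (M.reward z.1.1 z.2 x.1) z.1.2,
        le_max_right (M.reward z.1.1 z.2 x.1) z.1.2]
  · rw [sub_le_iff_le_add]
    refine max_le ?_ ?_
    · linarith [le_max_right z.1.2 0]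
    · linarith [le_max_left z.1.2 0]

/-- With y' = max{r, y}/γ, the term γ · excess' equals max{r, y, γĜ₁} - max{r, y}, so adding the
gain telescopes. -/
lemma excess_eq_gain_add (ω : ℕ → (S × ℝ) × A)
    (h : (ω 1).1.2 = max (M.reward (ω 0).1.1 (ω 0).2 (ω 1).1.1) (ω 0).1.2 / M.discount) :
    M.excess ω = M.gain (ω 0) (ω 1).1 + M.discount * M.excess (shift ω) := by
  have hG := M.extended.maxReturn_eq_max ω
  have hr := M.reward_nonneg (ω 0).1.1 (ω 0).2 (ω 1).1.1
  change M.extended.maxReturn ω = max (M.reward (ω 0).1.1 (ω 0).2 (ω 1).1.1)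
    (M.discount * M.extended.maxReturn (shift ω)) at hG
  have hmul : ∀ u v : ℝ, M.discount * max u v = max (M.discount * u) (M.discount * v) :=
    fun u v => mul_max_of_nonneg u v M.discount_nonneg
  have hrec : shift ω 0 = ω 1 := rfl
  rw [excess, excess, gain, hG, hrec, mul_sub, hmul, hmul, h, mul_zero]
  -- For γ = 0 the next record is the default value of a division by zero, but it enters only
  -- multiplied by γ.
  rcases M.discount_nonneg.eq_or_lt with h0 | h0
  · rw [← h0]
    simp only [zero_mul, max_self, sub_zero, add_zero, max_eq_left hr]
    rw [max_comm]
  · rw [mul_div_cancel₀ _ h0.ne', max_eq_left (le_max_of_le_left hr), ← max_assoc,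
      max_comm (ω 0).1.2 (M.reward _ _ _)]
    ring

section Policy

variable (π : Kernel (S × ℝ) A) [IsMarkovKernel π]

lemma extendedTrans_ae (z : (S × ℝ) × A) : ∀ᵐ x ∂M.extended.trans z,
    x.2 = max (M.reward z.1.1 z.2 x.1) z.1.2 / M.discount := by
  have hr : Measurable fun s' => M.reward z.1.1 z.2 s' := M.measurable_reward.comp
    (f := fun s' => (z.1.1, z.2, s')) (by fun_prop)
  change ∀ᵐ x ∂(M.trans (z.1.1, z.2)).map (fun s' =>
      (s', max (M.reward z.1.1 z.2 s') z.1.2 / M.discount)), _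
  rw [ae_map_iff (by fun_prop)]
  · exact ae_of_all _ fun _ => rfl
  · have : Measurable fun x : S × ℝ => M.reward z.1.1 z.2 x.1 := hr.comp measurable_fst
    exact measurableSet_eq_fun (by fun_prop) (by fun_prop)

/-- Rewards are non-negative, so one step makes any record non-negative, even from y < 0; for γ = 0
the quotient is 0. -/
lemma extendedTrans_ae_nonneg (z : (S × ℝ) × A) : ∀ᵐ x ∂M.extended.trans z, 0 ≤ x.2 := by
  filter_upwards [M.extendedTrans_ae z] with x hx
  rw [hx]
  exact div_nonneg (le_max_of_le_left (M.reward_nonneg _ _ _)) M.discount_nonneg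

instance : IsMarkovKernel (M.extended.pathFromStateAction π) :=
  inferInstanceAs (IsMarkovKernel (markovPath (M.extended.stepKernel π)))

/-- The state-action function of the excess. -/
noncomputable def excessQ (z : (S × ℝ) × A) : ℝ :=
  ∫ ω, M.excess ω ∂M.extended.pathFromStateAction π z

/-- The state function of the excess. -/
noncomputable def excessV (x : S × ℝ) : ℝ := ∫ a, M.excessQ π (x, a) ∂π x

lemma measurable_excessQ : Measurable (M.excessQ π) :=
  measurable_integral_kernel M.measurable_excess

lemma measurable_excessV : Measurable (M.excessV π) :=
  measurable_integral_kernel_prod (M.measurable_excessQ π)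

lemma abs_excessQ_le (z : (S × ℝ) × A) : |M.excessQ π z| ≤ M.rewardBound :=
  abs_integral_le_of_abs_le (ae_of_all _ M.abs_excess_le)

lemma abs_excessV_le (x : S × ℝ) : |M.excessV π x| ≤ M.rewardBound :=
  abs_integral_le_of_abs_le (ae_of_all _ fun _ => M.abs_excessQ_le π _)

lemma path_ae_zero_record (z : (S × ℝ) × A) :
    ∀ᵐ ω ∂M.extended.pathFromStateAction π z, (ω 0).1.2 = z.1.2 := by
  have hm : MeasurableSet {p : ((S × ℝ) × A) × ((S × ℝ) × A) | p.1.1.2 = z.1.2} :=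
    measurableSet_eq_fun (by fun_prop) (by fun_prop)
  rw [pathFromStateAction_eq]
  exact markovPath_ae_zero_one (M.extended.stepKernel π) hm (ae_of_all _ fun _ => rfl)

lemma excessQ_eq_zero {z : (S × ℝ) × A} (h : M.rewardBound ≤ z.1.2) : M.excessQ π z = 0 := by
  refine integral_eq_zero_of_ae ?_
  filter_upwards [M.path_ae_zero_record π z] with ω hω
  exact M.excess_eq_zero (hω ▸ h)

lemma qHat_eq (s : S) (a : A) (y : ℝ) :
    M.qHat π s a y = M.excessQ π ((s, y), a) + max y 0 := by
  have h : M.qHat π s a y =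
      ∫ ω, (M.excess ω + max y 0) ∂M.extended.pathFromStateAction π ((s, y), a) := by
    refine integral_congr_ae ?_
    filter_upwards [M.path_ae_zero_record π ((s, y), a)] with ω hω
    rw [excess, hω]
    ring
  rw [h, integral_add (integrable_of_abs_le M.measurable_excess M.abs_excess_le)
    (integrable_const _)]
  simp [excessQ]

/-- The initial record is 0, so nothing is subtracted and the excess is the full return. -/
lemma JHat_eq : M.JHat π = ∫ s, M.excessV π (s, 0) ∂M.init := by
  unfold JHat
  congr 1 with s
  have hm := M.extended.measurable_maxReturn
  have hb : ∀ ω, |max 0 (M.extended.maxReturn ω)| ≤ M.rewardBound := fun ω => by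
    rw [max_eq_right (M.extended.maxReturn_nonneg ω),
      abs_of_nonneg (M.extended.maxReturn_nonneg ω)]
    exact M.extended.maxReturn_le ω
  rw [vHat, integral_pathFromState _ _ (by fun_prop) hb, excessV]
  congr 1 with a
  exact (M.qHat_eq π s a 0).trans (by simp)

/-- The Bellman equation of the excess. -/
lemma excessQ_eq (z : (S × ℝ) × A) : M.excessQ π z =
    ∫ x, M.gain z x ∂M.extended.trans z + M.discount * ∫ x, M.excessV π x ∂M.extended.trans z := by
  have hstep : ∀ᵐ z' ∂M.extended.stepKernel π z,
      z'.1.2 = max (M.reward z.1.1 z.2 z'.1.1) z.1.2 / M.discount := by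
    have h := M.extendedTrans_ae z
    rw [← M.extended.stepKernel_map_fst π z] at h
    exact ae_of_ae_map measurable_fst.aemeasurable h
  have hrec : ∀ᵐ ω ∂M.extended.pathFromStateAction π z,
      (ω 1).1.2 = max (M.reward (ω 0).1.1 (ω 0).2 (ω 1).1.1) (ω 0).1.2 / M.discount := by
    refine markovPath_ae_zero_one _ (p := fun p : ((S × ℝ) × A) × ((S × ℝ) × A) =>
      p.2.1.2 = max (M.reward p.1.1.1 p.1.2 p.2.1.1) p.1.1.2 / M.discount) ?_ hstep
    have := M.measurable_reward.comp
      (f := fun p : ((S × ℝ) × A) × ((S × ℝ) × A) => (p.1.1.1, p.1.2, p.2.1.1)) (by fun_prop)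
    simp only [Function.comp_def] at this
    exact measurableSet_eq_fun (by fun_prop) (by fun_prop)
  have hgm : Measurable fun p : ((S × ℝ) × A) × ((S × ℝ) × A) => M.gain p.1 p.2.1 :=
    M.measurable_gain.comp (f := fun p : ((S × ℝ) × A) × ((S × ℝ) × A) => (p.1, p.2.1))
      (by fun_prop)
  have hpair : Measurable fun ω : ℕ → (S × ℝ) × A => (ω 0, ω 1) := by fun_prop
  have hgain : ∫ ω, M.gain (ω 0) (ω 1).1 ∂M.extended.pathFromStateAction π z =
      ∫ x, M.gain z x ∂M.extended.trans z := by
    have hgz : Measurable fun x => M.gain z x := M.measurable_gain.comp measurable_prodMk_left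
    rw [← integral_map (φ := fun ω : ℕ → (S × ℝ) × A => (ω 0, ω 1))
      (f := fun p : ((S × ℝ) × A) × ((S × ℝ) × A) => M.gain p.1 p.2.1) hpair.aemeasurable
      hgm.aestronglyMeasurable, pathFromStateAction_eq, markovPath_map_zero_one,
      integral_map (by fun_prop) hgm.aestronglyMeasurable, ← M.extended.stepKernel_map_fst π z,
      integral_map (by fun_prop) hgz.aestronglyMeasurable]
  -- By the Markov property the shifted trajectory is a fresh one started after one step of the
  -- state-action chain.
  have hshift : ∫ ω, M.excess (shift ω) ∂M.extended.pathFromStateAction π z =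
      ∫ x, M.excessV π x ∂M.extended.trans z := by
    rw [← integral_map (φ := shift) measurable_shift.aemeasurable
      M.measurable_excess.aestronglyMeasurable, pathFromStateAction_eq, markovPath_map_shift,
      integral_bind_of_abs_le M.measurable_excess M.abs_excess_le]
    exact M.extended.integral_stepKernel π (M.measurable_excessQ π) (M.abs_excessQ_le π) z
  rw [← hgain, ← hshift, ← integral_const_mul, ← integral_add]
  · refine integral_congr_ae ?_
    filter_upwards [hrec] with ω hω
    exact M.excess_eq_gain_add ω hω
  · exact integrable_of_abs_le (hgm.comp hpair) fun ω => M.abs_gain_le (ω 0) (ω 1).1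
  · exact (integrable_of_abs_le (M.measurable_excess.comp measurable_shift)
      fun ω => M.abs_excess_le _).const_mul _

end Policy

end MDP

/-! ### Visitation measures and the performance difference formula. -/

namespace MDP

section General

variable {X A : Type*} [MeasurableSpace X] [MeasurableSpace A] (N : MDP X A)
  (π : Kernel X A)

/-- The law of the state at time `t` under the policy `π`. -/
noncomputable def stateMeasure (t : ℕ) : Measure X := N.init.bind (N.stateLaw π t)

lemma stateMeasure_zero : N.stateMeasure π 0 = N.init := by
  rw [stateMeasure, stateLaw, Measure.id_comp]

lemma stateMeasure_succ (t : ℕ) :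
    N.stateMeasure π (t + 1) = (N.stateMeasure π t).bind (N.onPolicyTrans π) := by
  rw [stateMeasure, stateLaw, stateMeasure, Measure.comp_assoc]

lemma visitation_eq : N.visitation π =
    Measure.sum fun t : ℕ => ENNReal.ofReal (N.discount ^ t) • N.stateMeasure π t := rfl

lemma hasSum_integral_visitation {f : X → ℝ} (hf : Integrable f (N.visitation π)) :
    HasSum (fun t : ℕ => N.discount ^ t * ∫ x, f x ∂N.stateMeasure π t)
      (∫ x, f x ∂N.visitation π) := by
  have h := hasSum_integral_measure (N.visitation_eq π ▸ hf)
  rw [← visitation_eq] at h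
  refine h.congr_fun ?_
  intro t
  rw [integral_smul_measure, ENNReal.toReal_ofReal (pow_nonneg N.discount_nonneg t), smul_eq_mul]

/-- Every state law after time 0 is a mixture of one-step transitions, so checking the initial law
and single transitions is enough. -/
lemma visitation_ae {p : X → Prop} (hp : MeasurableSet {x | p x}) (h0 : ∀ᵐ x ∂N.init, p x)
    (hs : ∀ z, ∀ᵐ x ∂N.trans z, p x) : ∀ᵐ x ∂N.visitation π, p x := by
  rw [visitation_eq, Measure.ae_sum_iff' hp]
  intro t
  refine Measure.ae_smul_measure ?_ _
  cases t with
  | zero => rwa [stateMeasure_zero]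
  | succ t =>
    rw [stateMeasure_succ]
    refine Measure.ae_comp_of_ae_ae hp (ae_of_all _ fun x => ?_)
    rw [onPolicyTrans, Kernel.comp_apply]
    exact Measure.ae_comp_of_ae_ae hp (ae_of_all _ fun z => hs z)

variable [IsMarkovKernel π]

instance : IsMarkovKernel (N.onPolicyTrans π) := by unfold onPolicyTrans; infer_instance

instance isMarkovKernel_stateLaw (t : ℕ) : IsMarkovKernel (N.stateLaw π t) := by
  induction t with
  | zero => rw [stateLaw]; infer_instance
  | succ t ih => rw [stateLaw]; infer_instance

instance (t : ℕ) : IsProbabilityMeasure (N.stateMeasure π t) := by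
  unfold stateMeasure; infer_instance

lemma visitation_univ : N.visitation π Set.univ = ENNReal.ofReal (1 / (1 - N.discount)) := by
  rw [visitation_eq, Measure.sum_apply _ MeasurableSet.univ]
  simp only [Measure.smul_apply, measure_univ, smul_eq_mul, mul_one]
  rw [← ENNReal.ofReal_tsum_of_nonneg (fun t => pow_nonneg N.discount_nonneg t)
    (summable_geometric_of_lt_one N.discount_nonneg N.discount_lt_one),
    tsum_geometric_of_lt_one N.discount_nonneg N.discount_lt_one, one_div]

instance : IsFiniteMeasure (N.visitation π) := ⟨by rw [visitation_univ]; exact ENNReal.ofReal_lt_top⟩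

/-- The integral against the discounted visitation measure solves the Bellman equation. -/
lemma integral_visitation_eq {u b : X → ℝ} (hu : Measurable u) (hb : Measurable b) {C D : ℝ}
    (huC : ∀ x, |u x| ≤ C) (hbD : ∀ x, |b x| ≤ D)
    (h : ∀ x, u x = b x + N.discount * ∫ x', u x' ∂N.onPolicyTrans π x) :
    ∫ x, b x ∂N.visitation π = ∫ x, u x ∂N.init := by
  have hstep : ∀ t, ∫ x, u x ∂N.stateMeasure π t =
      ∫ x, b x ∂N.stateMeasure π t + N.discount * ∫ x, u x ∂N.stateMeasure π (t + 1) := by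
    intro t
    rw [stateMeasure_succ, integral_bind_of_abs_le hu huC, ← integral_const_mul, ← integral_add]
    · exact integral_congr_ae (ae_of_all _ h)
    · exact integrable_of_abs_le hb hbD
    · exact (integrable_of_abs_le (measurable_integral_kernel hu)
        fun x => abs_integral_le_of_abs_le (ae_of_all _ huC)).const_mul _
  -- The partial sums telescope; the remainder is at most γⁿ C and tends to 0.
  have hsum : ∀ n, ∑ t ∈ Finset.range n, N.discount ^ t * ∫ x, b x ∂N.stateMeasure π t =
      ∫ x, u x ∂N.init - N.discount ^ n * ∫ x, u x ∂N.stateMeasure π n := by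
    intro n
    induction n with
    | zero => simp [stateMeasure_zero]
    | succ n ih =>
      rw [Finset.sum_range_succ, ih, hstep n, pow_succ]
      ring
  have hlim : Filter.Tendsto (fun n => N.discount ^ n * ∫ x, u x ∂N.stateMeasure π n)
      Filter.atTop (nhds 0) := by
    refine squeeze_zero_norm (a := fun n => N.discount ^ n * C) (fun n => ?_) ?_
    · rw [norm_mul, norm_pow, Real.norm_of_nonneg N.discount_nonneg]
      exact mul_le_mul_of_nonneg_left (abs_integral_le_of_abs_le (ae_of_all _ huC))
        (pow_nonneg N.discount_nonneg n)
    · simpa using (tendsto_pow_atTop_nhds_zero_of_lt_one N.discount_nonneg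
        N.discount_lt_one).mul_const C
  have h1 := (N.hasSum_integral_visitation π (integrable_of_abs_le hb hbD)).tendsto_sum_nat
  simp_rw [hsum] at h1
  exact tendsto_nhds_unique h1 (by simpa using hlim.const_sub (∫ x, u x ∂N.init))

/-- A bounded solution of the Bellman inequality on a set supporting the transitions is bounded
by the discounted sum of the rewards. -/
lemma abs_le_of_bellman {u b : X → ℝ} {s : Set X} (hs : ∀ z, ∀ᵐ x ∂N.trans z, x ∈ s)
    (hu : Measurable u) {C D : ℝ} (hD : 0 ≤ D) (huC : ∀ x, |u x| ≤ C) (hbD : ∀ x ∈ s, |b x| ≤ D)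
    (h : ∀ x, u x = b x + N.discount * ∫ x', u x' ∂N.onPolicyTrans π x) {x : X} (hx : x ∈ s) :
    |u x| ≤ D / (1 - N.discount) := by
  have h1 : 0 < 1 - N.discount := sub_pos.2 N.discount_lt_one
  -- Iterating the Bellman inequality: D/(1 - γ) is the fixed point of t ↦ D + γt, and the crude
  -- bound C enters with the factor γⁿ.
  have key : ∀ n : ℕ, ∀ x ∈ s, |u x| ≤ D / (1 - N.discount) + N.discount ^ n * C := by
    intro n
    induction n with
    | zero =>
      intro x _
      have := div_nonneg hD h1.le
      linarith [huC x]
    | succ n ih =>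
      intro x hx
      have hP : |∫ x', u x' ∂N.onPolicyTrans π x| ≤
          D / (1 - N.discount) + N.discount ^ n * C := by
        rw [integral_onPolicyTrans _ _ hu huC]
        refine abs_integral_le_of_abs_le (ae_of_all _ fun a => abs_integral_le_of_abs_le ?_)
        filter_upwards [hs (x, a)] with x' hx' using ih x' hx'
      have h2 : D + N.discount * (D / (1 - N.discount)) = D / (1 - N.discount) := by
        field_simp
        ring
      calc |u x| ≤ |b x| + N.discount * |∫ x', u x' ∂N.onPolicyTrans π x| := by
            rw [h x]
            refine (abs_add_le _ _).trans_eq ?_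
            rw [abs_mul, abs_of_nonneg N.discount_nonneg]
        _ ≤ D + N.discount * (D / (1 - N.discount) + N.discount ^ n * C) :=
            add_le_add (hbD x hx) (mul_le_mul_of_nonneg_left hP N.discount_nonneg)
        _ = D / (1 - N.discount) + N.discount ^ (n + 1) * C := by
            rw [mul_add, ← add_assoc, h2, pow_succ]
            ring
  have hlim : Filter.Tendsto (fun n => D / (1 - N.discount) + N.discount ^ n * C)
      Filter.atTop (nhds (D / (1 - N.discount))) := by
    simpa using ((tendsto_pow_atTop_nhds_zero_of_lt_one N.discount_nonneg
        N.discount_lt_one).mul_const C).const_add (D / (1 - N.discount))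
  exact ge_of_tendsto' hlim fun n => key n x hx

end General

variable {S A : Type*} [MeasurableSpace S] [MeasurableSpace A] (M : MDP S A)
  (π π' : Kernel (S × ℝ) A)

lemma visitation_extended_ae_nonneg : ∀ᵐ x ∂M.extended.visitation π, 0 ≤ x.2 := by
  have hp : MeasurableSet {x : S × ℝ | 0 ≤ x.2} := measurableSet_le (by fun_prop) (by fun_prop)
  refine M.extended.visitation_ae π hp ?_ M.extendedTrans_ae_nonneg
  change ∀ᵐ x ∂M.init.prod (Measure.dirac (0 : ℝ)), 0 ≤ x.2
  rw [Measure.prod_dirac, ae_map_iff (by fun_prop) hp]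
  exact ae_of_all _ fun _ => le_rfl

variable [IsMarkovKernel π] [IsMarkovKernel π']

/-- The advantage of drawing the first action from `π'` instead of `π` before following `π'`. -/
noncomputable def policyGain (x : S × ℝ) : ℝ :=
  ∫ a, M.excessQ π' (x, a) ∂π' x - ∫ a, M.excessQ π' (x, a) ∂π x

lemma measurable_policyGain : Measurable (M.policyGain π π') :=
  (measurable_integral_kernel_prod (M.measurable_excessQ π')).sub
    (measurable_integral_kernel_prod (M.measurable_excessQ π'))

lemma abs_policyGain_le (x : S × ℝ) : |M.policyGain π π' x| ≤ M.rewardBound + M.rewardBound :=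
  (abs_sub _ _).trans (add_le_add
    (abs_integral_le_of_abs_le (ae_of_all _ fun _ => M.abs_excessQ_le π' _))
    (abs_integral_le_of_abs_le (ae_of_all _ fun _ => M.abs_excessQ_le π' _)))

lemma measurable_excessV_sub : Measurable fun x => M.excessV π' x - M.excessV π x :=
  (M.measurable_excessV π').sub (M.measurable_excessV π)

lemma abs_excessV_sub_le (x : S × ℝ) :
    |M.excessV π' x - M.excessV π x| ≤ M.rewardBound + M.rewardBound :=
  (abs_sub _ _).trans (add_le_add (M.abs_excessV_le π' x) (M.abs_excessV_le π x))

/-- The one-step gain is the same for both policies and cancels. -/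
lemma excessQ_sub (z : (S × ℝ) × A) : M.excessQ π' z - M.excessQ π z =
    M.discount * ∫ x, (M.excessV π' x - M.excessV π x) ∂M.extended.trans z := by
  rw [excessQ_eq, excessQ_eq M π, integral_sub
    (integrable_of_abs_le (M.measurable_excessV π') (M.abs_excessV_le π'))
    (integrable_of_abs_le (M.measurable_excessV π) (M.abs_excessV_le π))]
  ring

lemma integrable_excessQ (μ : Measure A) [IsFiniteMeasure μ] (x : S × ℝ) :
    Integrable (fun a => M.excessQ π (x, a)) μ :=
  integrable_of_abs_le ((M.measurable_excessQ π).comp measurable_prodMk_left)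
    fun a => M.abs_excessQ_le π (x, a)

lemma excessV_sub (x : S × ℝ) : M.excessV π' x - M.excessV π x = M.policyGain π π' x +
    M.discount * ∫ x', (M.excessV π' x' - M.excessV π x') ∂M.extended.onPolicyTrans π x := by
  rw [integral_onPolicyTrans _ _ (M.measurable_excessV_sub π π')
    (M.abs_excessV_sub_le π π'), ← integral_const_mul]
  simp_rw [← M.excessQ_sub π π']
  rw [integral_sub (M.integrable_excessQ π' _ x) (M.integrable_excessQ π _ x), policyGain, excessV,
    excessV]
  ring

/-- The performance difference formula. -/
lemma JHat_sub : M.JHat π' - M.JHat π = ∫ x, M.policyGain π π' x ∂M.extended.visitation π := by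
  have hmeas := M.measurable_excessV_sub π π'
  rw [M.extended.integral_visitation_eq π hmeas (M.measurable_policyGain π π')
    (M.abs_excessV_sub_le π π') (M.abs_policyGain_le π π') (M.excessV_sub π π')]
  change _ = ∫ x, (M.excessV π' x - M.excessV π x) ∂M.init.prod (Measure.dirac (0 : ℝ))
  have hm : Measurable fun s : S => (s, (0 : ℝ)) := by fun_prop
  rw [Measure.prod_dirac, integral_map hm.aemeasurable hmeas.aestronglyMeasurable, JHat_eq,
    JHat_eq, integral_sub]
  · exact integrable_of_abs_le ((M.measurable_excessV π').comp hm) fun _ => M.abs_excessV_le π' _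
  · exact integrable_of_abs_le ((M.measurable_excessV π).comp hm) fun _ => M.abs_excessV_le π _

/-- If, on the states with a non-negative record, the advantages of `π'` over `π` are small, then
so are the differences of their state-action functions. -/
lemma abs_excessQ_sub_le {D : ℝ} (hD : 0 ≤ D) (h : ∀ x, 0 ≤ x.2 → |M.policyGain π π' x| ≤ D)
    (z : (S × ℝ) × A) : |M.excessQ π' z - M.excessQ π z| ≤ D / (1 - M.discount) := by
  have h1 : 0 ≤ D / (1 - M.discount) := div_nonneg hD (sub_nonneg.2 M.discount_lt_one.le)
  -- The record of `z` may be negative: only the states reached after one step matter here, and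
  -- their records are non-negative almost surely.
  have h2 : |∫ x, (M.excessV π' x - M.excessV π x) ∂M.extended.trans z| ≤ D / (1 - M.discount) := by
    refine abs_integral_le_of_abs_le ?_
    filter_upwards [M.extendedTrans_ae_nonneg z] with x hx
    exact M.extended.abs_le_of_bellman π (s := {x | 0 ≤ x.2}) M.extendedTrans_ae_nonneg
      (M.measurable_excessV_sub π π') hD (M.abs_excessV_sub_le π π') h
      (M.excessV_sub π π') hx
  rw [excessQ_sub, abs_mul, abs_of_nonneg M.discount_nonneg]
  exact (mul_le_of_le_one_left (abs_nonneg _) M.discount_lt_one.le).trans h2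

end MDP

/-! ### Gradients, duality and measurability. -/

section Gradient

variable {α E : Type*} [MeasurableSpace α] {μ : Measure α} [NormedAddCommGroup E]
  [InnerProductSpace ℝ E] [CompleteSpace E]

lemma integrable_toDual_iff {g : α → E} (hg : AEStronglyMeasurable g μ) :
    Integrable (fun a => InnerProductSpace.toDual ℝ E (g a)) μ ↔ Integrable g μ := by
  have hm : AEStronglyMeasurable (fun a => InnerProductSpace.toDual ℝ E (g a)) μ :=
    (InnerProductSpace.toDual ℝ E).continuous.comp_aestronglyMeasurable hg
  rw [← integrable_norm_iff hm, ← integrable_norm_iff hg]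
  simp only [LinearIsometryEquiv.norm_map]

lemma toDual_integral {g : α → E} (hg : Integrable g μ) :
    InnerProductSpace.toDual ℝ E (∫ a, g a ∂μ) =
      ∫ a, InnerProductSpace.toDual ℝ E (g a) ∂μ := by
  ext v
  rw [ContinuousLinearMap.integral_apply
    ((integrable_toDual_iff hg.aestronglyMeasurable).2 hg)]
  simp only [InnerProductSpace.toDual_apply_apply]
  rw [real_inner_comm, ← integral_inner hg]
  simp only [real_inner_comm]

/-- The gradient of a family of differentiable functions is measurable if the functions are. -/
lemma measurable_gradient {m : ℕ} {f : EuclideanSpace ℝ (Fin m) → α → ℝ}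
    (hf : ∀ θ, Measurable (f θ)) (hd : ∀ a, Differentiable ℝ fun θ => f θ a)
    (θ : EuclideanSpace ℝ (Fin m)) : Measurable fun a => gradient (fun η => f η a) θ := by
  have hco : ∀ i, Measurable fun a => gradient (fun η => f η a) θ i := by
    intro i
    let v : EuclideanSpace ℝ (Fin m) := EuclideanSpace.single i 1
    -- Each coordinate of the gradient is a limit of measurable difference quotients with step 1/n.
    have hlim : ∀ a, Filter.Tendsto
        (fun n : ℕ => (n : ℝ) • (f (θ + (n : ℝ)⁻¹ • v) a - f θ a)) Filter.atTop
        (nhds (gradient (fun η => f η a) θ i)) := by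
      intro a
      have h1 : fderiv ℝ (fun η => f η a) θ v = gradient (fun η => f η a) θ i := by
        rw [← InnerProductSpace.toDual_symm_apply, EuclideanSpace.inner_single_right]
        simp [gradient]
      rw [← h1]
      refine (hd a θ).hasFDerivAt.lim v (c := fun n : ℕ => (n : ℝ)) (l := Filter.atTop) ?_
      simpa using tendsto_natCast_atTop_atTop (R := ℝ)
    refine measurable_of_tendsto_metrizable (fun n => ?_) (tendsto_pi_nhds.2 hlim)
    exact ((hf (θ + (n : ℝ)⁻¹ • v)).sub (hf θ)).const_smul (n : ℝ)
  have h2 : Measurable fun a => WithLp.toLp 2 fun i => gradient (fun η => f η a) θ i :=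
    (WithLp.measurable_toLp 2 _).comp (measurable_pi_lambda _ hco)
  exact h2

end Gradient

/-! ### Differentiating expectations under a parameterized policy. -/

namespace ParamPolicy

section Kernel

variable {Θ X A : Type*} [MeasurableSpace X] [MeasurableSpace A] {ν : Measure A}
  (π : ParamPolicy Θ X ν)

lemma measurable_density_right (θ : Θ) (x : X) : Measurable (π.density θ x) :=
  (π.measurable_density θ).comp measurable_prodMk_left

variable [SigmaFinite ν]

lemma toKernel_apply (θ : Θ) (x : X) :
    π.toKernel θ x = ν.withDensity fun a => ENNReal.ofReal (π.density θ x a) := rfl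

variable {F : Type*} [NormedAddCommGroup F] [NormedSpace ℝ F]

lemma integral_toKernel (θ : Θ) (x : X) (f : A → F) :
    ∫ a, f a ∂π.toKernel θ x = ∫ a, π.density θ x a • f a ∂ν := by
  rw [toKernel_apply, integral_withDensity_eq_integral_toReal_smul
    (π.measurable_density_right θ x).ennreal_ofReal (ae_of_all _ fun _ => ENNReal.ofReal_lt_top)]
  simp only [ENNReal.toReal_ofReal (π.density_nonneg θ x _)]

lemma integrable_toKernel_iff (θ : Θ) (x : X) (f : A → F) :
    Integrable f (π.toKernel θ x) ↔ Integrable (fun a => π.density θ x a • f a) ν := by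
  rw [toKernel_apply, integrable_withDensity_iff_integrable_smul'
    (π.measurable_density_right θ x).ennreal_ofReal (ae_of_all _ fun _ => ENNReal.ofReal_lt_top)]
  simp only [ENNReal.toReal_ofReal (π.density_nonneg θ x _)]

end Kernel

variable {m : ℕ} {X A : Type*} [MeasurableSpace X] [MeasurableSpace A] {ν : Measure A}
  (π : ParamPolicy (EuclideanSpace ℝ (Fin m)) X ν)

/-- The gradient of the density in the parameter. -/
noncomputable def gradDensity (θ : EuclideanSpace ℝ (Fin m)) (x : X) (a : A) :
    EuclideanSpace ℝ (Fin m) :=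
  gradient (fun η => π.density η x a) θ

/-- At each state, the gradient of the density is locally dominated by an integrable function. -/
def GradientLocallyDominated : Prop :=
  ∀ x θ₀, ∃ ε > 0, ∃ g : A → ℝ, Integrable g ν ∧
    ∀ᵐ a ∂ν, ∀ θ ∈ Metric.ball θ₀ ε, ‖π.gradDensity θ x a‖ ≤ g a

section Differentiable

variable {π}

lemma measurable_gradDensity 
    (hdiff : ∀ x a, Differentiable ℝ fun θ => π.density θ x a)
    (θ : EuclideanSpace ℝ (Fin m)) :
    Measurable fun p : X × A => π.gradDensity θ p.1 p.2 :=
  measurable_gradient (f := fun θ (p : X × A) => π.density θ p.1 p.2) π.measurable_density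
    (fun p => hdiff p.1 p.2) θ

lemma measurable_gradDensity_right 
    (hdiff : ∀ x a, Differentiable ℝ fun θ => π.density θ x a)
    (θ : EuclideanSpace ℝ (Fin m)) (x : X) :
    Measurable (π.gradDensity θ x) :=
  (measurable_gradDensity hdiff θ).comp measurable_prodMk_left

/-- The log-derivative trick `π ∇ ln π = ∇ π`, which also holds where the density vanishes. -/
lemma density_smul_gradient_log 
    (hdiff : ∀ x a, Differentiable ℝ fun θ => π.density θ x a)
    (θ : EuclideanSpace ℝ (Fin m)) (x : X) (a : A) :
    π.density θ x a • gradient (fun η => Real.log (π.density η x a)) θ = π.gradDensity θ x a := by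
  rcases (π.density_nonneg θ x a).eq_or_lt with h | h
  -- A zero of a non-negative density is a minimum in the parameter, so the gradient of the density
  -- vanishes there too.
  · have hmin : IsLocalMin (fun η => π.density η x a) θ :=
      Filter.Eventually.of_forall fun η => h.symm.le.trans (π.density_nonneg η x a)
    rw [← h, zero_smul, gradDensity, gradient, hmin.fderiv_eq_zero, map_zero]
  · rw [gradDensity, gradient, gradient, fderiv.log (hdiff x a θ) h.ne', map_smulₛₗ]
    simp [smul_smul, h.ne']

lemma integrable_smul_gradDensity
    (hdiff : ∀ x a, Differentiable ℝ fun θ => π.density θ x a)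
    (hdom : π.GradientLocallyDominated)
    (θ : EuclideanSpace ℝ (Fin m)) (x : X) {f : A → ℝ} (hf : Measurable f) {K : ℝ}
    (hK : ∀ a, |f a| ≤ K) : Integrable (fun a => f a • π.gradDensity θ x a) ν := by
  obtain ⟨ε, hε, g, hg, hb⟩ := hdom x θ
  refine (hg.const_mul K).mono'
    (hf.smul (measurable_gradDensity_right hdiff θ x)).aestronglyMeasurable ?_
  filter_upwards [hb] with a ha
  rw [norm_smul]
  exact mul_le_mul (hK a) (ha θ (Metric.mem_ball_self hε)) (norm_nonneg _)
    ((abs_nonneg _).trans (hK a))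

variable [SigmaFinite ν]

/-- Differentiation of the expectation of a bounded function of the action. -/
lemma hasGradientAt_integral_toKernel
    (hdiff : ∀ x a, Differentiable ℝ fun θ => π.density θ x a)
    (hdom : π.GradientLocallyDominated)
    (θ : EuclideanSpace ℝ (Fin m)) (x : X) {f : A → ℝ} (hf : Measurable f) {K : ℝ}
    (hK : ∀ a, |f a| ≤ K) :
    HasGradientAt (fun η => ∫ a, f a ∂π.toKernel η x) (∫ a, f a • π.gradDensity θ x a ∂ν) θ := by
  have hint := integrable_smul_gradDensity hdiff hdom θ x hf hK
  obtain ⟨ε, hε, g, hg, hb⟩ := hdom x θ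
  rw [hasGradientAt_iff_hasFDerivAt, toDual_integral hint]
  simp only [integral_toKernel]
  refine hasFDerivAt_integral_of_dominated_of_fderiv_le (bound := fun a => K * g a)
    (F' := fun η a => InnerProductSpace.toDual ℝ _ (f a • π.gradDensity η x a))
    (Metric.ball_mem_nhds θ hε) ?_ ?_ ?_ ?_ (hg.const_mul K) ?_
  · exact Filter.Eventually.of_forall fun η =>
      ((π.measurable_density_right η x).smul hf).aestronglyMeasurable
  · exact (π.integrable_toKernel_iff θ x f).1 (integrable_of_abs_le hf hK)
  · exact ((integrable_toDual_iff hint.aestronglyMeasurable).2 hint).aestronglyMeasurable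
  · filter_upwards [hb] with a ha η hη
    rw [LinearIsometryEquiv.norm_map, norm_smul]
    exact mul_le_mul (hK a) (ha η hη) (norm_nonneg _) ((abs_nonneg _).trans (hK a))
  · refine ae_of_all _ fun a η _ => ?_
    have h := ((hdiff x a η).hasGradientAt.hasFDerivAt).mul_const (f a)
    rw [map_smul]
    exact h

/-- Mean value inequality on the ball. The dominating function, whose neighbourhood may depend on
`x`, is used only to differentiate at single points; the constant comes from the `L¹` bound. -/
lemma abs_integral_toKernel_sub_le
    (hdiff : ∀ x a, Differentiable ℝ fun θ => π.density θ x a)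
    (hdom : π.GradientLocallyDominated)
    {θ₀ : EuclideanSpace ℝ (Fin m)} {ε C : ℝ} {x : X}
    (hC : ∀ θ ∈ Metric.ball θ₀ ε, ∫ a, ‖π.gradDensity θ x a‖ ∂ν ≤ C) {f : A → ℝ}
    (hf : Measurable f) {K : ℝ} (hK0 : 0 ≤ K) (hK : ∀ a, |f a| ≤ K)
    {η θ : EuclideanSpace ℝ (Fin m)}
    (hη : η ∈ Metric.ball θ₀ ε) (hθ : θ ∈ Metric.ball θ₀ ε) :
    |∫ a, f a ∂π.toKernel η x - ∫ a, f a ∂π.toKernel θ x| ≤ K * C * ‖η - θ‖ := by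
  refine (convex_ball θ₀ ε).norm_image_sub_le_of_norm_hasFDerivWithin_le
    (f := fun η => ∫ a, f a ∂π.toKernel η x)
    (fun ζ _ => (hasGradientAt_integral_toKernel hdiff hdom ζ x hf
      hK).hasFDerivAt.hasFDerivWithinAt) (fun ζ hζ => ?_) hθ hη
  rw [LinearIsometryEquiv.norm_map]
  have hG : Integrable (fun a => ‖π.gradDensity ζ x a‖) ν := by
    simpa using (integrable_smul_gradDensity hdiff hdom ζ x (f := fun _ => 1)
      measurable_const (K := 1) (by simp)).norm
  calc ‖∫ a, f a • π.gradDensity ζ x a ∂ν‖ ≤ ∫ a, K * ‖π.gradDensity ζ x a‖ ∂ν := by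
        refine norm_integral_le_of_norm_le (hG.const_mul K) (ae_of_all _ fun a => ?_)
        rw [norm_smul]
        exact mul_le_mul_of_nonneg_right (hK a) (norm_nonneg _)
    _ = K * ∫ a, ‖π.gradDensity ζ x a‖ ∂ν := integral_const_mul _ _
    _ ≤ K * C := mul_le_mul_of_nonneg_left (hC ζ hζ) hK0

/-- The gradients of the densities integrate to zero. -/
lemma integral_gradDensity
    (hdiff : ∀ x a, Differentiable ℝ fun θ => π.density θ x a)
    (hdom : π.GradientLocallyDominated)
    (θ : EuclideanSpace ℝ (Fin m)) (x : X) : ∫ a, π.gradDensity θ x a ∂ν = 0 := by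
  have h := hasGradientAt_integral_toKernel hdiff hdom θ x (f := fun _ => 1)
    measurable_const (K := 1) (by simp)
  simp only [integral_const, probReal_univ, smul_eq_mul, mul_one, one_smul] at h
  exact h.unique (hasGradientAt_const θ 1)

end Differentiable

end ParamPolicy

/-! ### The gradient of the objective, in terms of the excess. -/

namespace MDP

variable {S A : Type*} [MeasurableSpace S] [MeasurableSpace A] (M : MDP S A) {ν : Measure A}
  [SigmaFinite ν] {m : ℕ} (π : ParamPolicy (EuclideanSpace ℝ (Fin m)) (S × ℝ) ν)

/-- The integral of the state-action function of the excess against the gradient of the policy. -/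
noncomputable def innerGradient (θ : EuclideanSpace ℝ (Fin m)) (x : S × ℝ) :
    EuclideanSpace ℝ (Fin m) :=
  ∫ a, M.excessQ (π.toKernel θ) (x, a) • π.gradDensity θ x a ∂ν

variable {π} {θ : EuclideanSpace ℝ (Fin m)}

lemma rewardBound_nonneg_of_policy (κ : Kernel (S × ℝ) A) [IsMarkovKernel κ] :
    0 ≤ M.rewardBound := by
  obtain ⟨s⟩ : Nonempty S := nonempty_of_isProbabilityMeasure M.init
  exact (abs_nonneg _).trans (M.abs_excessV_le κ (s, 0))

lemma measurable_excessQ_right (κ : Kernel (S × ℝ) A) [IsMarkovKernel κ] (x : S × ℝ) :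
    Measurable fun a => M.excessQ κ (x, a) :=
  (M.measurable_excessQ κ).comp measurable_prodMk_left

lemma measurable_innerGradient (hdiff : ∀ x a, Differentiable ℝ fun θ => π.density θ x a) :
    Measurable (M.innerGradient π θ) := by
  have h : Measurable fun p : (S × ℝ) × A =>
      M.excessQ (π.toKernel θ) p • π.gradDensity θ p.1 p.2 :=
    (M.measurable_excessQ _).smul (ParamPolicy.measurable_gradDensity hdiff θ)
  exact h.stronglyMeasurable.integral_prod_right'.measurable

/-- Extends the Lipschitz estimate from y ∈ [0, R̄] to all y ≥ 0, for functions that vanish above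
R̄. It is applied both to a single Q and to a difference of two. -/
lemma abs_excessQ_integral_sub_le
    (hdiff : ∀ x a, Differentiable ℝ fun θ => π.density θ x a)
    (hdom : π.GradientLocallyDominated) {ε C : ℝ}
    (hC : ∀ η ∈ Metric.ball θ ε, ∀ s : S, ∀ y ∈ Set.Icc 0 M.rewardBound,
      ∫ a, ‖π.gradDensity η (s, y) a‖ ∂ν ≤ C)
    {f : (S × ℝ) × A → ℝ} (hf : Measurable f) {K : ℝ} (hK0 : 0 ≤ K) (hK : ∀ z, |f z| ≤ K)
    (hf0 : ∀ z, M.rewardBound ≤ z.1.2 → f z = 0) (hC0 : 0 ≤ C)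
    {η : EuclideanSpace ℝ (Fin m)} (hη : η ∈ Metric.ball θ ε) {x : S × ℝ} (hx : 0 ≤ x.2) :
    |∫ a, f (x, a) ∂π.toKernel η x - ∫ a, f (x, a) ∂π.toKernel θ x| ≤ K * C * ‖η - θ‖ := by
  rcases le_total M.rewardBound x.2 with h | h
  · have h0 : ∀ a, f (x, a) = 0 := fun a => hf0 _ h
    simp only [h0, integral_zero, sub_zero, abs_zero]
    positivity
  · have hε : 0 < ε := Metric.nonempty_ball.1 ⟨η, hη⟩
    exact ParamPolicy.abs_integral_toKernel_sub_le hdiff hdom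
      (fun ζ hζ => hC ζ hζ x.1 x.2 ⟨hx, h⟩) (hf.comp measurable_prodMk_left) hK0
      (fun a => hK (x, a)) hη (Metric.mem_ball_self hε)

/-- Differentiation of the one-step expectation of the state-action function at `θ`, integrated
against the visitation measure at `θ`. -/
lemma hasGradientAt_integral_visitation
    (hdiff : ∀ x a, Differentiable ℝ fun θ => π.density θ x a)
    (hdom : π.GradientLocallyDominated) {ε C : ℝ} (hε : 0 < ε) (hC0 : 0 ≤ C)
    (hC : ∀ η ∈ Metric.ball θ ε, ∀ s : S, ∀ y ∈ Set.Icc 0 M.rewardBound,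
      ∫ a, ‖π.gradDensity η (s, y) a‖ ∂ν ≤ C) :
    Integrable (M.innerGradient π θ) (M.extended.visitation (π.toKernel θ)) ∧
    HasGradientAt (fun η => ∫ x, ∫ a, M.excessQ (π.toKernel θ) (x, a) ∂π.toKernel η x
        ∂M.extended.visitation (π.toKernel θ))
      (∫ x, M.innerGradient π θ x ∂M.extended.visitation (π.toKernel θ)) θ := by
  have hm : ∀ η, Measurable fun x => ∫ a, M.excessQ (π.toKernel θ) (x, a) ∂π.toKernel η x :=
    fun η => measurable_integral_kernel_prod (M.measurable_excessQ _)
  have hG := M.measurable_innerGradient (θ := θ) hdiff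
  -- This form asks for the derivative at `θ` only, plus a Lipschitz estimate towards `θ` on a ball
  -- common to almost all states.
  have key := hasFDerivAt_integral_of_dominated_loc_of_lip'
    (μ := M.extended.visitation (π.toKernel θ))
    (F := fun η x => ∫ a, M.excessQ (π.toKernel θ) (x, a) ∂π.toKernel η x)
    (F' := fun x => InnerProductSpace.toDual ℝ _ (M.innerGradient π θ x))
    (bound := fun _ => M.rewardBound * C) (Metric.ball_mem_nhds θ hε)
    (fun η _ => (hm η).aestronglyMeasurable)
    (integrable_of_abs_le (hm θ) (M.abs_excessV_le (π.toKernel θ)))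
    ((InnerProductSpace.toDual ℝ _).continuous.comp_aestronglyMeasurable
      hG.aestronglyMeasurable) ?_ (integrable_const _) ?_
  · have hint := (integrable_toDual_iff hG.aestronglyMeasurable).1 key.1
    refine ⟨hint, ?_⟩
    rw [hasGradientAt_iff_hasFDerivAt, toDual_integral hint]
    exact key.2
  · filter_upwards [M.visitation_extended_ae_nonneg (π.toKernel θ)] with x hx η hη
    exact M.abs_excessQ_integral_sub_le hdiff hdom hC (M.measurable_excessQ _)
      (M.rewardBound_nonneg_of_policy (π.toKernel θ)) (M.abs_excessQ_le _)
      (fun z => M.excessQ_eq_zero _) hC0 hη hx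
  · exact ae_of_all _ fun x => (ParamPolicy.hasGradientAt_integral_toKernel hdiff hdom θ x
      (M.measurable_excessQ_right _ x) fun a => M.abs_excessQ_le _ (x, a)).hasFDerivAt

/-- The policy gradient theorem for the max-reward objective. -/
lemma hasGradientAt_JHat
    (hdiff : ∀ x a, Differentiable ℝ fun θ => π.density θ x a)
    (hdom : π.GradientLocallyDominated) {ε C : ℝ} (hε : 0 < ε) (hC0 : 0 ≤ C)
    (hC : ∀ η ∈ Metric.ball θ ε, ∀ s : S, ∀ y ∈ Set.Icc 0 M.rewardBound,
      ∫ a, ‖π.gradDensity η (s, y) a‖ ∂ν ≤ C) :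
    HasGradientAt (fun η => M.JHat (π.toKernel η))
      (∫ x, M.innerGradient π θ x ∂M.extended.visitation (π.toKernel θ)) θ := by
  have hR := M.rewardBound_nonneg_of_policy (π.toKernel θ)
  have hγ : 0 < 1 - M.discount := sub_pos.2 M.discount_lt_one
  obtain ⟨-, hF⟩ := M.hasGradientAt_integral_visitation hdiff hdom hε hC0 hC
  set d := M.extended.visitation (π.toKernel θ) with hd
  set F := fun η => ∫ x, ∫ a, M.excessQ (π.toKernel θ) (x, a) ∂π.toKernel η x ∂d with hFdef
  -- One factor `C` comes from the bound on Q_η - Q_θ, the other from π_η - π_θ; the last factor is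
  -- the mass of the visitation measure.
  set L := M.rewardBound * C / (1 - M.discount) * C * d.real Set.univ with hL
  have hbound : ∀ η ∈ Metric.ball θ ε,
      ‖M.JHat (π.toKernel η) - F η - (M.JHat (π.toKernel θ) - F θ)‖ ≤ L * ‖η - θ‖ ^ 2 := by
    intro η hη
    set κ := π.toKernel θ
    set κ' := π.toKernel η
    have hgain : ∀ x : S × ℝ, 0 ≤ x.2 →
        |M.policyGain κ κ' x| ≤ M.rewardBound * C * ‖η - θ‖ := fun x hx =>
      M.abs_excessQ_integral_sub_le hdiff hdom hC (M.measurable_excessQ κ') hR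
        (M.abs_excessQ_le κ') (fun z => M.excessQ_eq_zero κ') hC0 hη hx
    have hQ := M.abs_excessQ_sub_le κ κ' (by positivity) hgain
    have hdiffQ : ∀ x : S × ℝ, 0 ≤ x.2 →
        |∫ a, (M.excessQ κ' (x, a) - M.excessQ κ (x, a)) ∂κ' x -
          ∫ a, (M.excessQ κ' (x, a) - M.excessQ κ (x, a)) ∂κ x| ≤
        M.rewardBound * C * ‖η - θ‖ / (1 - M.discount) * C * ‖η - θ‖ := fun x hx =>
      M.abs_excessQ_integral_sub_le hdiff hdom hC
        (f := fun z => M.excessQ κ' z - M.excessQ κ z)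
        ((M.measurable_excessQ κ').sub (M.measurable_excessQ κ)) (by positivity) hQ
        (fun z hz => by rw [M.excessQ_eq_zero κ' hz, M.excessQ_eq_zero κ hz, sub_zero])
        hC0 hη hx
    have hm : ∀ ρ ρ' : Kernel (S × ℝ) A, [IsMarkovKernel ρ] → [IsMarkovKernel ρ'] →
        Integrable (fun x => ∫ a, M.excessQ ρ (x, a) ∂ρ' x) d := fun ρ ρ' _ _ =>
      integrable_of_abs_le (measurable_integral_kernel_prod (M.measurable_excessQ ρ))
        fun x => abs_integral_le_of_abs_le (ae_of_all _ fun a => M.abs_excessQ_le ρ (x, a))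
    -- The performance difference formula minus F(η) - F(θ): only Q_η - Q_θ, tested against π_η -
    -- π_θ, remains.
    have heq : M.JHat κ' - F η - (M.JHat κ - F θ) =
        ∫ x, (∫ a, (M.excessQ κ' (x, a) - M.excessQ κ (x, a)) ∂κ' x -
          ∫ a, (M.excessQ κ' (x, a) - M.excessQ κ (x, a)) ∂κ x) ∂d := by
      have h1 : ∀ (ρ : Kernel (S × ℝ) A) [IsMarkovKernel ρ] (x : S × ℝ),
          ∫ a, (M.excessQ κ' (x, a) - M.excessQ κ (x, a)) ∂ρ x =
          ∫ a, M.excessQ κ' (x, a) ∂ρ x - ∫ a, M.excessQ κ (x, a) ∂ρ x := fun ρ _ x =>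
        integral_sub (M.integrable_excessQ κ' _ x) (M.integrable_excessQ κ _ x)
      simp only [h1]
      have hs : ∀ ρ : Kernel (S × ℝ) A, [IsMarkovKernel ρ] → Integrable (fun x =>
          ∫ a, M.excessQ κ' (x, a) ∂ρ x - ∫ a, M.excessQ κ (x, a) ∂ρ x) d :=
        fun ρ _ => (hm κ' ρ).sub (hm κ ρ)
      rw [integral_sub (hs κ') (hs κ),
        integral_sub (hm κ' κ') (hm κ κ'), integral_sub (hm κ' κ) (hm κ κ)]
      have h2 := M.JHat_sub κ κ'
      simp only [policyGain] at h2
      rw [integral_sub (hm κ' κ') (hm κ' κ)] at h2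
      simp only [hFdef]
      linarith
    rw [heq]
    refine (norm_integral_le_of_norm_le_const (C := M.rewardBound * C * ‖η - θ‖ /
      (1 - M.discount) * C * ‖η - θ‖) ?_).trans_eq ?_
    · filter_upwards [M.visitation_extended_ae_nonneg κ] with x hx using hdiffQ x hx
    · rw [hL]
      ring
  have hE : HasFDerivAt (fun η => M.JHat (π.toKernel η) - F η)
      (0 : EuclideanSpace ℝ (Fin m) →L[ℝ] ℝ) θ := by
    refine HasFDerivAt.of_isLittleO ?_
    simp only [zero_apply, sub_zero]
    refine Asymptotics.IsBigO.trans_isLittleO (g := fun η => ‖η - θ‖ ^ 2) ?_ ?_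
    · refine Asymptotics.IsBigO.of_bound L ?_
      filter_upwards [Metric.ball_mem_nhds θ hε] with η hη
      rw [Real.norm_of_nonneg (sq_nonneg ‖η - θ‖)]
      exact hbound η hη
    · exact (Asymptotics.isLittleO_norm_pow_id one_lt_two).comp_tendsto
        (tendsto_sub_nhds_zero_iff.2 Filter.tendsto_id)
  rw [hasGradientAt_iff_hasFDerivAt]
  refine ((hE.add hF.hasFDerivAt).congr_fderiv (zero_add _)).congr_of_eventuallyEq
    (Filter.Eventually.of_forall fun η => ?_)
  simp

end MDP

end MaxReward

/-! ### The policy gradient formula with `qHat` and the score function. -/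

theorem theorem3 {S A : Type*} [MeasurableSpace S] [MeasurableSpace A]
    (M : MaxReward.MDP S A) (ν : Measure A) [SigmaFinite ν] (m : ℕ)
    (π : MaxReward.ParamPolicy (EuclideanSpace ℝ (Fin m)) (S × ℝ) ν)
    -- the density is differentiable in the parameter
    (hdiff : ∀ x a, Differentiable ℝ fun θ => π.density θ x a)
    -- at each extended state, its gradient is locally dominated by an integrable function of `a`
    (hdom : ∀ x θ₀, ∃ ε > 0, ∃ g : A → ℝ, Integrable g ν ∧
      ∀ᵐ a ∂ν, ∀ θ ∈ Metric.ball θ₀ ε, ‖gradient (fun η => π.density η x a) θ‖ ≤ g a)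
    -- the `L¹` norm of the gradient is bounded, locally in `θ`, over the states with `y ∈ [0, R̄]`
    (hunif : ∀ θ₀, ∃ ε > 0, ∃ C : ℝ, ∀ θ ∈ Metric.ball θ₀ ε,
      ∀ s : S, ∀ y ∈ Set.Icc 0 M.rewardBound,
        ∫ a, ‖gradient (fun η => π.density η (s, y) a) θ‖ ∂ν ≤ C)
    (θ : EuclideanSpace ℝ (Fin m)) :
    let d := M.extended.visitation (π.toKernel θ)
    let dLaw := M.extended.visitationLaw (π.toKernel θ)
    let score : S × ℝ → A → EuclideanSpace ℝ (Fin m) :=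
      fun x a => gradient (fun η => Real.log (π.density η x a)) θ
    let inner : S × ℝ → EuclideanSpace ℝ (Fin m) :=
      fun x => ∫ a, M.qHat (π.toKernel θ) x.1 a x.2 • score x a ∂(π.toKernel θ x)
    d Set.univ = ENNReal.ofReal (1 / (1 - M.discount)) ∧
    (∀ x, Integrable (fun a => M.qHat (π.toKernel θ) x.1 a x.2 • score x a) (π.toKernel θ x)) ∧
    Integrable inner d ∧
    HasGradientAt (fun η => M.JHat (π.toKernel η)) (∫ x, inner x ∂d) θ ∧
    HasGradientAt (fun η => M.JHat (π.toKernel η))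
      ((1 / (1 - M.discount)) • ∫ x, inner x ∂dLaw) θ := by
  intro d dLaw score inner
  have hγ : 0 < 1 - M.discount := sub_pos.2 M.discount_lt_one
  have hmass : d Set.univ = ENNReal.ofReal (1 / (1 - M.discount)) :=
    M.extended.visitation_univ (π.toKernel θ)
  have hdens : ∀ x a, π.density θ x a • (M.qHat (π.toKernel θ) x.1 a x.2 • score x a) =
      M.excessQ (π.toKernel θ) (x, a) • π.gradDensity θ x a +
        max x.2 0 • π.gradDensity θ x a := fun x a => by
    rw [smul_comm, MaxReward.ParamPolicy.density_smul_gradient_log hdiff, M.qHat_eq, add_smul]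
  have hint1 : ∀ x, Integrable
      (fun a => M.excessQ (π.toKernel θ) (x, a) • π.gradDensity θ x a) ν := fun x =>
    MaxReward.ParamPolicy.integrable_smul_gradDensity hdiff hdom θ x
      (M.measurable_excessQ_right _ x) fun a => M.abs_excessQ_le _ (x, a)
  have hint2 : ∀ x : S × ℝ, Integrable (fun a => max x.2 0 • π.gradDensity θ x a) ν := fun x =>
    MaxReward.ParamPolicy.integrable_smul_gradDensity hdiff hdom θ x
      (f := fun _ => max x.2 0) measurable_const fun _ => le_rfl
  -- The baseline y⁺ integrates to zero against the gradient of the density, so `qHat` may be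
  -- replaced by the excess.
  have hinner : inner = M.innerGradient π θ := by
    funext x
    simp only [inner]
    rw [π.integral_toKernel θ x]
    simp only [hdens]
    rw [integral_add (hint1 x) (hint2 x), integral_smul,
      MaxReward.ParamPolicy.integral_gradDensity hdiff hdom, smul_zero, add_zero]
    rfl
  obtain ⟨ε, hε, C, hC⟩ := hunif θ
  have hC' : ∀ η ∈ Metric.ball θ ε, ∀ s : S, ∀ y ∈ Set.Icc 0 M.rewardBound,
      ∫ a, ‖π.gradDensity η (s, y) a‖ ∂ν ≤ |C| := fun η hη s y hy =>
    (hC η hη s y hy).trans (le_abs_self C)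
  have hgrad := M.hasGradientAt_JHat hdiff hdom hε (abs_nonneg C) hC'
  rw [← hinner] at hgrad
  refine ⟨hmass, fun x => ?_, ?_, hgrad, ?_⟩
  · rw [π.integrable_toKernel_iff θ x]
    simp only [hdens]
    exact (hint1 x).add (hint2 x)
  · rw [hinner]
    exact (M.hasGradientAt_integral_visitation hdiff hdom hε (abs_nonneg C) hC').1
  · have hlaw : (1 / (1 - M.discount)) • ∫ x, inner x ∂dLaw = ∫ x, inner x ∂d := by
      change (1 / (1 - M.discount)) • ∫ x, inner x ∂((d Set.univ)⁻¹ • d) = _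
      rw [integral_smul_measure, hmass, ENNReal.toReal_inv,
        ENNReal.toReal_ofReal (one_div_nonneg.2 hγ.le), smul_smul,
        mul_inv_cancel₀ (one_div_ne_zero hγ.ne'), one_smul]
    rw [hlaw]
    exact hgrad
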